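/- Let $f:[0,1]\to\mathbb{R}$ be continuous, non-increasing and concave, with $f(0)=1$ and $f(1)\ge 0$, and let $K_f=\{(x,y): 0\le x\le 1,\ 0\le y\le f(x)\}$, which is a convex disk. Write $|S|$ for the area of $S\subset\mathbb{R}^2$. A family of sets is a packing if the interiors of its members are mutually disjoint, and a tiling if moreover its members cover $\mathbb{R}^2$. The upper density of a family $\mathcal F$ is $$d_+(\mathcal F)=\limsup_{r\to\infty}\frac{1}{|rB|}\sum_{K\in\mathcal F,\ K\cap rB\ne\emptyset}|K|,$$ where $rB$ is the closed disk of radius $r$ about the origin. Let $\delta_T(K_f)$ be the supremum of $d_+(\mathcal F)$ over all packings $\mathcal F$ by translates of $K_f$, and $\delta_L(K_f)$ the supremum over those packings whose translation vectors form a lattice $\mathcal L(\mathbf v,\mathbf w)=\{k\mathbf v+l\mathbf w: k,l\in\mathbb Z\}$ with $\mathbf v,\mathbf w$ linearly independent. For $0\le x\le 1$ let $S^f(x)=([0,x]\times[0,1])\cup([x,1]\times[0,f(x)])$ be the (possibly degenerate) L-shaped polygon with vertices $(0,0),(0,1),(x,1),(x,f(x)),(1,f(x)),(1,0)$. Then for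 every $x\in[0,1]$ the polygon $S^f(x)$ contains $K_f$, the vectors $(x-1,1)$ and $(x,f(x))$ are linearly independent, and the translates of $S^f(x)$ by $\mathcal L((x-1,1),(x,f(x)))$ form a tiling of $\mathbb{R}^2$. Moreover the minimum $A^f=\min\{|S^f(x)|:0\le x\le 1\}$ is attained, and $$\delta_L(K_f)=\delta_T(K_f)=\frac{|K_f|}{A^f}.$$ -/

import Mathlib

open Set MeasureTheory Filter
open scoped ENNReal

/-- The Euclidean plane. -/
abbrev Plane : Type := EuclideanSpace ℝ (Fin 2)

/-- A family of sets is a packing of the plane if the interiors are mutually disjoint. -/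
def IsPacking {ι : Type*} (F : ι → Set Plane) : Prop :=
  Pairwise fun i j => Disjoint (interior (F i)) (interior (F j))

/-- A family of sets is a covering of the plane if every point lies in some member. -/
def IsCovering {ι : Type*} (F : ι → Set Plane) : Prop :=
  ∀ z : Plane, ∃ i, z ∈ F i

/-- A tiling is a family that is both a packing and a covering. -/
def IsTiling {ι : Type*} (F : ι → Set Plane) : Prop :=
  IsPacking F ∧ IsCovering F

/-- The upper density of a family with respect to a bounded domain `D`: the total area of the
members that meet `D`, divided by the area of `D`. -/
noncomputable def upperDensityIn {ι : Type*} (F : ι → Set Plane) (D : Set Plane) : ℝ≥0∞ :=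
  (∑' i : {i : ι // (F i ∩ D).Nonempty}, volume (F i)) / volume D

/-- The upper density of a family: the limit superior, as `r → ∞`, of the upper densities with
respect to the disk of radius `r` about the origin. -/
noncomputable def upperDensity {ι : Type*} (F : ι → Set Plane) : ℝ≥0∞ :=
  limsup (fun r : ℝ => upperDensityIn F (Metric.closedBall 0 r)) atTop

/-- The family `K + X` of the translates `K + x`, `x ∈ X`. -/
def translates (K X : Set Plane) : X → Set Plane :=
  fun x => (fun y => y + (x : Plane)) '' K

/-- The set of integer combinations of `v` and `w`; it is a lattice if `v` and `w` are linearly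
independent. -/
def planeLattice (v w : Plane) : Set Plane :=
  {z | ∃ k l : ℤ, z = (k : ℝ) • v + (l : ℝ) • w}

/-- The translative packing density of `K`: the supremum of the upper densities of all packings
by translates of `K`. -/
noncomputable def translativePackingDensity (K : Set Plane) : ℝ≥0∞ :=
  ⨆ (X : Set Plane) (_ : IsPacking (translates K X)), upperDensity (translates K X)

/-- The lattice packing density of `K`: the supremum of the upper densities of all packings
`K + Λ`, where `Λ` is a lattice. -/
noncomputable def latticePackingDensity (K : Set Plane) : ℝ≥0∞ :=
  ⨆ (v : Plane) (w : Plane) (_ : LinearIndependent ℝ ![v, w])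
    (_ : IsPacking (translates K (planeLattice v w))),
    upperDensity (translates K (planeLattice v w))

/-- The region under the graph of `f` over `[0, 1]`. -/
def regionUnder (f : ℝ → ℝ) : Set Plane :=
  {p | 0 ≤ p 0 ∧ p 0 ≤ 1 ∧ 0 ≤ p 1 ∧ p 1 ≤ f (p 0)}

/-- The closed L-shaped polygon with vertices `(0,0)`, `(0,1)`, `(x,1)`, `(x,f x)`, `(1,f x)`,
`(1,0)`. -/
def stairPolygon (f : ℝ → ℝ) (x : ℝ) : Set Plane :=
  {p | (0 ≤ p 0 ∧ p 0 ≤ x ∧ 0 ≤ p 1 ∧ p 1 ≤ 1) ∨ (x ≤ p 0 ∧ p 0 ≤ 1 ∧ 0 ≤ p 1 ∧ p 1 ≤ f x)}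

/-- The least area of the polygons `stairPolygon f x`, `0 ≤ x ≤ 1`. -/
noncomputable def minStairArea (f : ℝ → ℝ) : ℝ≥0∞ :=
  ⨅ x ∈ Icc (0 : ℝ) 1, volume (stairPolygon f x)

/-! ### Planar measure and metric facts -/

/-! Lower bound: the stair polygon of least area tiles by a lattice, and shrinking each tile to the
copy of the region inside it gives a lattice packing of the required density.

Upper bound: attach to each translation vector `u` the unit square with lower left vertex `u`. The
legs of the region force the squares of two coordinatewise incomparable vectors to be disjoint
(`packing_incomparable`). If `v` lies in the square at `u`, then `v - u` is not below the graph of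
`f` (`packing_comparable`), so with `s = v 0 - u 0` the corner of the square beyond `v` has area at
most `(1 - s) * (1 - f s) = 1 - stairArea f s ≤ 1 - m`, where `m` is the least stair area. Remove
from each square the corners at the vectors that cover `u` in the order. The remaining cells are
disjoint, and each vector is removed from at most one square, so `N` cells have total area at least
`N - N * (1 - m) = N * m`. A single cell may be small; only the average matters. This is
`card_le_volume_add`, and letting the disk grow gives the density bound. -/

theorem Plane.norm_le_two {p : Plane} (h0 : 0 ≤ p 0) (h0' : p 0 ≤ 1) (h1 : 0 ≤ p 1)
    (h1' : p 1 ≤ 1) : ‖p‖ ≤ 2 := by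
  rw [EuclideanSpace.norm_eq, Fin.sum_univ_two, Real.norm_eq_abs, Real.norm_eq_abs, sq_abs, sq_abs]
  apply Real.sqrt_le_iff.mpr
  constructor <;> nlinarith

theorem Plane.measurableSet_coord {s t : Set ℝ} (hs : MeasurableSet s) (ht : MeasurableSet t) :
    MeasurableSet {p : Plane | p 0 ∈ s ∧ p 1 ∈ t} := by
  have h (i : Fin 2) : Measurable fun p : Plane => p i := by fun_prop
  exact (h 0 hs).inter (h 1 ht)

theorem Plane.volume_coord {s t : Set ℝ} (hs : MeasurableSet s) (ht : MeasurableSet t) :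
    volume {p : Plane | p 0 ∈ s ∧ p 1 ∈ t} = volume s * volume t := by
  have hm : MeasurableSet (Set.univ.pi ![s, t]) := by
    apply MeasurableSet.univ_pi
    intro i
    fin_cases i <;> assumption
  have h := (PiLp.volume_preserving_ofLp (Fin 2)).measure_preimage hm.nullMeasurableSet
  rw [volume_pi_pi, Fin.prod_univ_two] at h
  change _ = volume s * volume t at h
  rw [← h]
  congr 1
  ext p
  simp [Fin.forall_fin_two]

theorem Plane.volume_closedBall_pos {r : ℝ} (hr : 0 < r) :
    volume (Metric.closedBall (0 : Plane) r) ≠ 0 :=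
  (Metric.measure_closedBall_pos volume 0 hr).ne'

theorem Plane.volume_closedBall_ne_top (r : ℝ) :
    volume (Metric.closedBall (0 : Plane) r) ≠ ∞ :=
  measure_closedBall_lt_top.ne

/-- Makes boundary effects negligible: changing the radius by a constant does not affect the
limiting density. -/
theorem Plane.tendsto_volume_closedBall_div (c : ℝ) :
    Tendsto (fun r : ℝ => volume (Metric.closedBall (0 : Plane) (r + c)) /
      volume (Metric.closedBall (0 : Plane) r)) atTop (nhds 1) := by
  have h1 : Tendsto (fun r : ℝ => ENNReal.ofReal ((1 + c / r) ^ 2)) atTop (nhds 1) := by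
    have h2 : Tendsto (fun r : ℝ => (1 + c / r) ^ 2) atTop (nhds ((1 + 0) ^ 2)) :=
      ((tendsto_const_nhds (x := (1 : ℝ))).add (tendsto_const_nhds.div_atTop tendsto_id)).pow 2
    simpa using ENNReal.tendsto_ofReal h2
  refine h1.congr' ?_
  filter_upwards [eventually_gt_atTop 0, eventually_gt_atTop (-c)] with r hr hrc
  rw [Measure.addHaar_closedBall' volume 0 (by linarith : 0 ≤ r + c),
    Measure.addHaar_closedBall' volume 0 hr.le,
    ENNReal.mul_div_mul_right _ _ (volume_closedBall_pos one_pos) (volume_closedBall_ne_top 1),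
    ← ENNReal.ofReal_div_of_pos (by positivity), finrank_euclideanSpace_fin, ← div_pow]
  congr 2
  field_simp

theorem Plane.tendsto_mul_volume_closedBall_div (a : ℝ≥0∞) (c : ℝ) :
    Tendsto (fun r : ℝ => a * (volume (Metric.closedBall (0 : Plane) (r + c)) /
      volume (Metric.closedBall (0 : Plane) r))) atTop (nhds a) := by
  simpa using ENNReal.Tendsto.const_mul (a := a) (Plane.tendsto_volume_closedBall_div c)
    (Or.inl one_ne_zero)

theorem mem_translates {K X : Set Plane} {i : X} {p : Plane} :
    p ∈ translates K X i ↔ p - i ∈ K := by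
  constructor
  · rintro ⟨y, hy, rfl⟩
    simpa using hy
  · intro h
    exact ⟨p - i, h, by simp⟩

theorem volume_translates (K X : Set Plane) (i : X) : volume (translates K X i) = volume K := by
  have : translates K X i = (fun p : Plane => p + -(i : Plane)) ⁻¹' K := by
    ext p
    rw [mem_translates, sub_eq_add_neg, mem_preimage]
  rw [this, measure_preimage_add_right]

/-! ### Stair polygons -/

/-- The area of `stairPolygon f x`. -/
def stairArea (f : ℝ → ℝ) (x : ℝ) : ℝ := x + (1 - x) * f x

theorem volume_stairPolygon {f : ℝ → ℝ} {x : ℝ} (hx : x ∈ Icc (0 : ℝ) 1) (hf : 0 ≤ f x) :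
    volume (stairPolygon f x) = ENNReal.ofReal (stairArea f x) := by
  have h1 : volume {p : Plane | p 0 ∈ Icc 0 x ∧ p 1 ∈ Icc (0 : ℝ) 1} = ENNReal.ofReal x := by
    rw [Plane.volume_coord measurableSet_Icc measurableSet_Icc]
    simp
  have h2 (s : Set ℝ) (hs : MeasurableSet s) (hv : volume s = ENNReal.ofReal (1 - x)) :
      volume {p : Plane | p 0 ∈ s ∧ p 1 ∈ Icc 0 (f x)} = ENNReal.ofReal ((1 - x) * f x) := by
    rw [Plane.volume_coord hs measurableSet_Icc, hv, Real.volume_Icc, sub_zero,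
      ← ENNReal.ofReal_mul (by linarith [hx.2])]
  have hA : ENNReal.ofReal (stairArea f x) = ENNReal.ofReal x + ENNReal.ofReal ((1 - x) * f x) :=
    ENNReal.ofReal_add hx.1 (mul_nonneg (by linarith [hx.2]) hf)
  rw [hA]
  apply le_antisymm
  · rw [← h1, ← h2 (Icc x 1) measurableSet_Icc (by simp)]
    refine (measure_mono ?_).trans (measure_union_le _ _)
    rintro p (⟨ha, hb, hc, hd⟩ | ⟨ha, hb, hc, hd⟩)
    · exact Or.inl ⟨⟨ha, hb⟩, hc, hd⟩
    · exact Or.inr ⟨⟨ha, hb⟩, hc, hd⟩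
  -- The half-open interval makes the two rectangles disjoint without changing the area.
  · rw [← h1, ← h2 (Ioc x 1) measurableSet_Ioc (by simp), ← measure_union]
    · apply measure_mono
      rintro p (⟨⟨ha, hb⟩, hc, hd⟩ | ⟨⟨ha, hb⟩, hc, hd⟩)
      · exact Or.inl ⟨ha, hb, hc, hd⟩
      · exact Or.inr ⟨ha.le, hb, hc, hd⟩
    · rw [Set.disjoint_left]
      rintro p ⟨⟨-, hb⟩, -⟩ ⟨⟨ha, -⟩, -⟩
      exact absurd hb ha.not_ge
    · exact Plane.measurableSet_coord measurableSet_Ioc measurableSet_Icc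

/-- The standing assumptions on the function that bounds the convex disk. -/
structure IsQuarterProfile (f : ℝ → ℝ) : Prop where
  concaveOn : ConcaveOn ℝ (Icc 0 1) f
  antitoneOn : AntitoneOn f (Icc 0 1)
  continuousOn : ContinuousOn f (Icc 0 1)
  map_zero : f 0 = 1
  map_one_nonneg : 0 ≤ f 1

namespace IsQuarterProfile

variable {f : ℝ → ℝ} (hf : IsQuarterProfile f)
include hf

theorem le_one {x : ℝ} (hx : x ∈ Icc (0 : ℝ) 1) : f x ≤ 1 :=
  hf.map_zero ▸ hf.antitoneOn ⟨le_rfl, zero_le_one⟩ hx hx.1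

theorem nonneg {x : ℝ} (hx : x ∈ Icc (0 : ℝ) 1) : 0 ≤ f x :=
  hf.map_one_nonneg.trans (hf.antitoneOn hx ⟨zero_le_one, le_rfl⟩ hx.2)

/-- Moving a fraction `t` of the way towards `1` decreases `f` by at most that fraction. -/
theorem mul_le {x t : ℝ} (hx : x ∈ Icc (0 : ℝ) 1) (ht : t ∈ Icc (0 : ℝ) 1) :
    (1 - t) * f x ≤ f (x + t * (1 - x)) := by
  have h := hf.concaveOn.2 hx ⟨zero_le_one, le_rfl⟩ (sub_nonneg.mpr ht.2) ht.1 (by ring)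
  simp only [smul_eq_mul] at h
  rw [show (1 - t) * x + t * 1 = x + t * (1 - x) by ring] at h
  nlinarith [mul_nonneg ht.1 hf.map_one_nonneg]

theorem one_sub_le {x : ℝ} (hx : x ∈ Icc (0 : ℝ) 1) : 1 - x ≤ f x := by
  simpa [hf.map_zero] using hf.mul_le ⟨le_rfl, zero_le_one⟩ hx

/-- Supplies the room needed to overlap interiors rather than boundaries. Moving the fraction `(f a
- b) / 2` of the way to `1` costs at most that much height, since `f a ≤ 1`. -/
theorem exists_gt_of_lt {a b : ℝ} (ha : 0 ≤ a) (ha1 : a < 1) (hb : 0 ≤ b) (hab : b < f a) :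
    ∃ a', a < a' ∧ a' < 1 ∧ b < f a' := by
  have h1 := hf.le_one ⟨ha, ha1.le⟩
  refine ⟨a + (f a - b) / 2 * (1 - a), by nlinarith, by nlinarith, ?_⟩
  refine lt_of_lt_of_le ?_ (hf.mul_le ⟨ha, ha1.le⟩ ⟨by linarith, by linarith⟩)
  nlinarith

theorem stairArea_pos {x : ℝ} (hx : x ∈ Icc (0 : ℝ) 1) : 0 < stairArea f x := by
  unfold stairArea
  nlinarith [hf.one_sub_le hx, hx.1, hx.2]

theorem exists_stairArea_min : ∃ x ∈ Icc (0 : ℝ) 1, ∀ y ∈ Icc (0 : ℝ) 1,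
    stairArea f x ≤ stairArea f y := by
  have hc : ContinuousOn (stairArea f) (Icc 0 1) := by
    unfold stairArea
    exact continuousOn_id.add ((continuousOn_const.sub continuousOn_id).mul hf.continuousOn)
  exact isCompact_Icc.exists_isMinOn ⟨0, le_rfl, zero_le_one⟩ hc

theorem minStairArea_eq {x : ℝ} (hx : x ∈ Icc (0 : ℝ) 1)
    (hmin : ∀ y ∈ Icc (0 : ℝ) 1, stairArea f x ≤ stairArea f y) :
    minStairArea f = ENNReal.ofReal (stairArea f x) := by
  apply le_antisymm
  · rw [← volume_stairPolygon hx (hf.nonneg hx)]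
    exact iInf₂_le x hx
  · refine le_iInf₂ fun y hy => ?_
    rw [volume_stairPolygon hy (hf.nonneg hy)]
    exact ENNReal.ofReal_le_ofReal (hmin y hy)

theorem regionUnder_subset_stairPolygon {x : ℝ} (hx : x ∈ Icc (0 : ℝ) 1) :
    regionUnder f ⊆ stairPolygon f x := by
  rintro p ⟨h0, h1, h2, h3⟩
  rcases le_total (p 0) x with h | h
  · exact Or.inl ⟨h0, h, h2, h3.trans (hf.le_one ⟨h0, h1⟩)⟩
  · exact Or.inr ⟨h, h1, h2, h3.trans (hf.antitoneOn hx ⟨h0, h1⟩ h)⟩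

theorem stairPolygon_subset_unitSquare {x : ℝ} (hx : x ∈ Icc (0 : ℝ) 1) {p : Plane}
    (hp : p ∈ stairPolygon f x) : (0 ≤ p 0 ∧ p 0 ≤ 1) ∧ 0 ≤ p 1 ∧ p 1 ≤ 1 := by
  rcases hp with ⟨ha, hb, hc, hd⟩ | ⟨ha, hb, hc, hd⟩
  · exact ⟨⟨ha, hb.trans hx.2⟩, hc, hd⟩
  · exact ⟨⟨hx.1.trans ha, hb⟩, hc, hd.trans (hf.le_one hx)⟩

theorem norm_le_two_of_mem_stairPolygon {x : ℝ} (hx : x ∈ Icc (0 : ℝ) 1) {p : Plane}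
    (hp : p ∈ stairPolygon f x) : ‖p‖ ≤ 2 := by
  obtain ⟨⟨h1, h2⟩, h3, h4⟩ := hf.stairPolygon_subset_unitSquare hx hp
  exact Plane.norm_le_two h1 h2 h3 h4

theorem norm_le_two_of_mem_regionUnder {p : Plane} (hp : p ∈ regionUnder f) : ‖p‖ ≤ 2 :=
  hf.norm_le_two_of_mem_stairPolygon ⟨le_rfl, zero_le_one⟩
    (hf.regionUnder_subset_stairPolygon ⟨le_rfl, zero_le_one⟩ hp)

/-! ### Packings by translates of the region -/

theorem box_subset_interior {X : Set Plane} (u : X) {a b : ℝ} (ha : a ∈ Icc (0 : ℝ) 1)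
    (hb : b ≤ f a) :
    {p : Plane | p 0 ∈ Ioo ((u : Plane) 0) ((u : Plane) 0 + a) ∧
      p 1 ∈ Ioo ((u : Plane) 1) ((u : Plane) 1 + b)} ⊆
      interior (translates (regionUnder f) X u) := by
  apply interior_maximal
  · rintro p ⟨⟨h1, h2⟩, h3, h4⟩
    rw [mem_translates]
    have h5 : p 0 - (u : Plane) 0 ∈ Icc (0 : ℝ) 1 := ⟨by linarith, by linarith [ha.2]⟩
    have h6 := hf.antitoneOn h5 ha (by linarith)
    refine ⟨?_, ?_, ?_, ?_⟩ <;> simp only [PiLp.sub_apply] <;> linarith [h5.2]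
  · have h (i : Fin 2) : Continuous fun p : Plane => p i := by fun_prop
    exact (isOpen_Ioo.preimage (h 0)).inter (isOpen_Ioo.preimage (h 1))

/-- Distinct members of a packing do not contain overlapping anchored boxes. -/
theorem not_boxes_overlap {X : Set Plane} (hX : IsPacking (translates (regionUnder f) X))
    {u v : Plane} (hu : u ∈ X) (hv : v ∈ X) (huv : u ≠ v) {a a' b b' : ℝ}
    (ha : a ∈ Icc (0 : ℝ) 1) (hb : b ≤ f a) (ha' : a' ∈ Icc (0 : ℝ) 1) (hb' : b' ≤ f a')
    (h0 : max (u 0) (v 0) < min (u 0 + a) (v 0 + a'))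
    (h1 : max (u 1) (v 1) < min (u 1 + b) (v 1 + b')) : False := by
  have hd := hX (i := ⟨u, hu⟩) (j := ⟨v, hv⟩) (fun h => huv (congrArg Subtype.val h))
  obtain ⟨s, hs, hs'⟩ := exists_between h0
  obtain ⟨t, ht, ht'⟩ := exists_between h1
  rw [max_lt_iff] at hs ht
  rw [lt_min_iff] at hs' ht'
  refine Set.disjoint_left.mp hd (hf.box_subset_interior ⟨u, hu⟩ ha hb (?_ : (!₂[s, t] : Plane) ∈ _))
    (hf.box_subset_interior ⟨v, hv⟩ ha' hb' ?_)
  · exact ⟨⟨hs.1, hs'.1⟩, ht.1, ht'.1⟩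
  · exact ⟨⟨hs.2, hs'.2⟩, ht.2, ht'.2⟩

/-- Otherwise `v` lies strictly below the graph of the copy at `u`, and a slightly wider box at `u`
overlaps the box of side `1 / 2` at `v`, which fits because `f (1 / 2) ≥ 1 / 2`. -/
theorem packing_comparable {X : Set Plane} (hX : IsPacking (translates (regionUnder f) X))
    {u v : Plane} (hu : u ∈ X) (hv : v ∈ X) (huv : u ≠ v) (h0 : u 0 ≤ v 0) (h1 : u 1 ≤ v 1)
    (h : v 0 < u 0 + 1) : f (v 0 - u 0) ≤ v 1 - u 1 := by
  by_contra! hlt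
  obtain ⟨a, ha, ha1, hb⟩ := hf.exists_gt_of_lt (by linarith) (by linarith) (by linarith) hlt
  refine hf.not_boxes_overlap hX hu hv huv (a := a) (a' := 1 / 2) (b' := 1 / 2)
    ⟨by linarith, ha1.le⟩ le_rfl ⟨by norm_num, by norm_num⟩ ?_ ?_ ?_
  · linarith [hf.one_sub_le (x := 1 / 2) ⟨by norm_num, by norm_num⟩]
  · rw [max_lt_iff, lt_min_iff, lt_min_iff]
    refine ⟨⟨?_, ?_⟩, ?_, ?_⟩ <;> linarith
  · rw [max_lt_iff, lt_min_iff, lt_min_iff]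
    refine ⟨⟨?_, ?_⟩, ?_, ?_⟩ <;> linarith

/-- Otherwise a wide box along the horizontal leg at `u` crosses a tall box along the vertical leg
at `v`. -/
theorem packing_incomparable {X : Set Plane} (hX : IsPacking (translates (regionUnder f) X))
    {u v : Plane} (hu : u ∈ X) (hv : v ∈ X) (h0 : u 0 ≤ v 0) (h1 : v 1 < u 1)
    (h : v 0 < u 0 + 1) : v 1 + 1 ≤ u 1 := by
  by_contra! hlt
  have huv : u ≠ v := fun h => by simp [h] at h1
  have hpos := hf.one_sub_le (x := v 0 - u 0) ⟨by linarith, by linarith⟩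
  obtain ⟨a, ha, ha1, hb⟩ := hf.exists_gt_of_lt (a := v 0 - u 0) (b := 0)
    (by linarith) (by linarith) le_rfl (by linarith)
  obtain ⟨c, hc, hc1, hd⟩ := hf.exists_gt_of_lt (a := 0) (b := u 1 - v 1) le_rfl one_pos
    (by linarith) (by rw [hf.map_zero]; linarith)
  refine hf.not_boxes_overlap hX hu hv huv (a := a) (a' := c) ⟨by linarith, ha1.le⟩ le_rfl
    ⟨hc.le, hc1.le⟩ le_rfl ?_ ?_
  · rw [max_lt_iff, lt_min_iff, lt_min_iff]
    refine ⟨⟨?_, ?_⟩, ?_, ?_⟩ <;> linarith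
  · rw [max_lt_iff, lt_min_iff, lt_min_iff]
    refine ⟨⟨?_, ?_⟩, ?_, ?_⟩ <;> linarith

end IsQuarterProfile

/-! ### Cells of a finite packing -/

namespace Plane

/-- The coordinatewise order on the plane. -/
def CoordLE (u v : Plane) : Prop := u 0 ≤ v 0 ∧ u 1 ≤ v 1

theorem CoordLE.trans {u v w : Plane} (h : CoordLE u v) (h' : CoordLE v w) : CoordLE u w :=
  ⟨h.1.trans h'.1, h.2.trans h'.2⟩

theorem CoordLE.antisymm {u v : Plane} (h : CoordLE u v) (h' : CoordLE v u) : u = v := by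
  ext i
  fin_cases i
  · exact le_antisymm h.1 h'.1
  · exact le_antisymm h.2 h'.2

/-- The half-open unit square with lower left vertex `u`. -/
def unitSquare (u : Plane) : Set Plane :=
  {p | p 0 ∈ Ico (u 0) (u 0 + 1) ∧ p 1 ∈ Ico (u 1) (u 1 + 1)}

theorem coordLE_of_mem_unitSquare {u p : Plane} (h : p ∈ unitSquare u) : CoordLE u p :=
  ⟨h.1.1, h.2.1⟩

theorem mem_unitSquare_of_coordLE {u v p : Plane} (h : p ∈ unitSquare u) (huv : CoordLE u v)
    (hvp : CoordLE v p) : v ∈ unitSquare u :=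
  ⟨⟨huv.1, hvp.1.trans_lt h.1.2⟩, huv.2, hvp.2.trans_lt h.2.2⟩

theorem volume_unitSquare (u : Plane) : volume (unitSquare u) = 1 := by
  unfold unitSquare
  rw [volume_coord measurableSet_Ico measurableSet_Ico]
  simp

/-- The part of the unit square at `u` that lies above and to the right of `v`. -/
def squareCorner (u v : Plane) : Set Plane :=
  {p | p 0 ∈ Ico (v 0) (u 0 + 1) ∧ p 1 ∈ Ico (v 1) (u 1 + 1)}

theorem measurableSet_squareCorner (u v : Plane) : MeasurableSet (squareCorner u v) :=
  measurableSet_coord measurableSet_Ico measurableSet_Ico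

theorem mem_squareCorner {u v p : Plane} (h : p ∈ unitSquare u) (hvp : CoordLE v p) :
    p ∈ squareCorner u v :=
  ⟨⟨hvp.1, h.1.2⟩, hvp.2, h.2.2⟩

theorem volume_squareCorner {u v : Plane} (h : v ∈ unitSquare u) :
    volume (squareCorner u v) = ENNReal.ofReal ((1 - (v 0 - u 0)) * (1 - (v 1 - u 1))) := by
  unfold squareCorner
  rw [volume_coord measurableSet_Ico measurableSet_Ico, Real.volume_Ico, Real.volume_Ico,
    ← ENNReal.ofReal_mul (by linarith [h.1.2])]
  congr 1
  ring

/-- Incomparable points of `T` are lower left vertices of disjoint unit squares. -/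
def SquareSeparated (T : Set Plane) : Prop :=
  ∀ u ∈ T, ∀ v ∈ T, u 0 ≤ v 0 → v 1 < u 1 → v 0 < u 0 + 1 → v 1 + 1 ≤ u 1

theorem SquareSeparated.comparable {T : Set Plane} (hT : SquareSeparated T) {u v p : Plane}
    (hu : u ∈ T) (hv : v ∈ T) (hpu : p ∈ unitSquare u) (hpv : p ∈ unitSquare v) :
    CoordLE u v ∨ CoordLE v u := by
  have key : ∀ {u v : Plane}, u ∈ T → v ∈ T → p ∈ unitSquare u → p ∈ unitSquare v →
      u 0 ≤ v 0 → CoordLE u v := by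
    intro u v hu hv hpu hpv h
    refine ⟨h, ?_⟩
    by_contra! hlt
    have := hT u hu v hv h hlt (hpv.1.1.trans_lt hpu.1.2)
    linarith [hpv.2.2, hpu.2.1]
  rcases le_total (u 0) (v 0) with h | h
  · exact Or.inl (key hu hv hpu hpv h)
  · exact Or.inr (key hv hu hpv hpu h)

open scoped Classical in
/-- The points of `T` in the unit square at `u` that cover `u` in the coordinatewise order. -/
noncomputable def children (T : Finset Plane) (u : Plane) : Finset Plane :=
  T.filter fun v => v ∈ unitSquare u ∧ v ≠ u ∧
    ∀ w ∈ T, CoordLE u w → CoordLE w v → w = u ∨ w = v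

theorem mem_children {T : Finset Plane} {u v : Plane} : v ∈ children T u ↔ v ∈ T ∧
    v ∈ unitSquare u ∧ v ≠ u ∧ ∀ w ∈ T, CoordLE u w → CoordLE w v → w = u ∨ w = v := by
  simp [children]

/-- No point has two parents: their squares would share it, so the parents would be comparable, and
one would lie strictly between the other and the child. -/
theorem sum_card_children_le {T : Finset Plane} (hT : SquareSeparated T) :
    ∑ u ∈ T, (children T u).card ≤ T.card := by
  classical
  rw [← Finset.card_biUnion]
  · exact Finset.card_le_card (Finset.biUnion_subset.mpr fun u _ v hv => (mem_children.mp hv).1)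
  · intro u hu u' hu' hne
    refine Finset.disjoint_left.mpr fun v hv hv' => ?_
    obtain ⟨-, h1, h2, h3⟩ := mem_children.mp hv
    obtain ⟨-, h1', h2', h3'⟩ := mem_children.mp hv'
    rcases hT.comparable hu hu' h1 h1' with h | h
    · rcases h3 u' hu' h (coordLE_of_mem_unitSquare h1') with h4 | h4
      · exact hne h4.symm
      · exact h2' h4.symm
    · rcases h3' u hu h (coordLE_of_mem_unitSquare h1) with h4 | h4
      · exact hne h4
      · exact h2 h4.symm

/-- The unit square at `u` without the corners at the children of `u`. -/
noncomputable def cell (T : Finset Plane) (u : Plane) : Set Plane :=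
  unitSquare u \ ⋃ v ∈ children T u, squareCorner u v

theorem measurableSet_cell (T : Finset Plane) (u : Plane) : MeasurableSet (cell T u) :=
  (measurableSet_coord measurableSet_Ico measurableSet_Ico).diff
    (Finset.measurableSet_biUnion _ fun v _ => measurableSet_squareCorner u v)

theorem not_coordLE_of_mem_cell {T : Finset Plane} {u v p : Plane} (hp : p ∈ cell T u)
    (hv : v ∈ T) (huv : CoordLE u v) (hne : v ≠ u) : ¬ CoordLE v p := by
  classical
  intro hvp
  -- A point with least coordinate sum is minimal in the order, hence a child of `u` whose corner
  -- contains `p`.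
  obtain ⟨w, hw, hmin⟩ := Finset.exists_min_image
    (T.filter fun w => w ≠ u ∧ CoordLE u w ∧ CoordLE w p) (fun w => w 0 + w 1)
    ⟨v, Finset.mem_filter.mpr ⟨hv, hne, huv, hvp⟩⟩
  obtain ⟨hwT, hwu, huw, hwp⟩ := Finset.mem_filter.mp hw
  refine hp.2 (mem_iUnion₂.mpr ⟨w, mem_children.mpr ⟨hwT,
    mem_unitSquare_of_coordLE hp.1 huw hwp, hwu, fun z hz huz hzw => ?_⟩,
    mem_squareCorner hp.1 hwp⟩)
  by_cases hzu : z = u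
  · exact Or.inl hzu
  · have := hmin z (Finset.mem_filter.mpr ⟨hz, hzu, huz, hzw.trans hwp⟩)
    exact Or.inr (hzw.antisymm ⟨by linarith [hzw.2], by linarith [hzw.1]⟩)

theorem pairwiseDisjoint_cell {T : Finset Plane} (hT : SquareSeparated T) :
    (T : Set Plane).PairwiseDisjoint (cell T) := by
  intro u hu v hv hne
  refine Set.disjoint_left.mpr fun p hpu hpv => ?_
  rcases hT.comparable hu hv hpu.1 hpv.1 with h | h
  · exact not_coordLE_of_mem_cell hpu hv h hne.symm (coordLE_of_mem_unitSquare hpv.1)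
  · exact not_coordLE_of_mem_cell hpv hu h hne (coordLE_of_mem_unitSquare hpu.1)

theorem one_le_volume_cell_add {T : Finset Plane} {u : Plane} {σ : ℝ≥0∞}
    (hσ : ∀ v ∈ children T u, volume (squareCorner u v) ≤ σ) :
    1 ≤ volume (cell T u) + (children T u).card * σ := by
  rw [← volume_unitSquare u]
  have hsub : unitSquare u ⊆ cell T u ∪ ⋃ v ∈ children T u, squareCorner u v := by
    rw [cell, sdiff_union_self]
    exact subset_union_left
  refine (measure_mono hsub).trans ((measure_union_le _ _).trans ?_)
  gcongr
  refine (measure_biUnion_finset_le _ _).trans ?_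
  simpa using Finset.sum_le_card_nsmul _ _ _ hσ

theorem card_le_volume_add {T : Finset Plane} (hT : SquareSeparated T) {σ : ℝ≥0∞}
    (hσ : ∀ u ∈ T, ∀ v ∈ children T u, volume (squareCorner u v) ≤ σ) {B : Set Plane}
    (hB : ∀ u ∈ T, unitSquare u ⊆ B) : (T.card : ℝ≥0∞) ≤ volume B + T.card * σ := by
  calc (T.card : ℝ≥0∞) = ∑ u ∈ T, 1 := by simp
    _ ≤ ∑ u ∈ T, (volume (cell T u) + (children T u).card * σ) :=
      Finset.sum_le_sum fun u hu => one_le_volume_cell_add (hσ u hu)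
    _ = volume (⋃ u ∈ T, cell T u) + ((∑ u ∈ T, (children T u).card : ℕ) : ℝ≥0∞) * σ := by
      rw [Finset.sum_add_distrib, measure_biUnion_finset (pairwiseDisjoint_cell hT)
        fun u _ => measurableSet_cell T u, Nat.cast_sum, Finset.sum_mul]
    _ ≤ volume B + T.card * σ := by
      gcongr
      · exact iUnion₂_subset fun u hu => sdiff_subset.trans (hB u hu)
      · exact sum_card_children_le hT

end Plane

/-! ### The upper bound for the density of a packing -/

namespace IsQuarterProfile

variable {f : ℝ → ℝ} (hf : IsQuarterProfile f)
include hf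

open Plane

theorem card_mul_le_volume {X : Set Plane} (hX : IsPacking (translates (regionUnder f) X))
    {m : ℝ} (hm : ∀ y ∈ Icc (0 : ℝ) 1, m ≤ stairArea f y) (hm0 : 0 ≤ m) {T : Finset Plane}
    (hT : ↑T ⊆ X) {B : Set Plane} (hB : ∀ u ∈ T, unitSquare u ⊆ B) :
    T.card * ENNReal.ofReal m ≤ volume B := by
  have hm1 : m ≤ 1 := by simpa [stairArea, hf.map_zero] using hm 0 ⟨le_rfl, zero_le_one⟩
  have hsep : SquareSeparated (T : Set Plane) := fun u hu v hv h0 h1 h =>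
    hf.packing_incomparable hX (hT hu) (hT hv) h0 h1 h
  have key := card_le_volume_add hsep (σ := ENNReal.ofReal (1 - m)) (fun u hu v hv => ?_) hB
  · have h : (T.card : ℝ≥0∞) * ENNReal.ofReal m + T.card * ENNReal.ofReal (1 - m) = T.card := by
      rw [← mul_add, ← ENNReal.ofReal_add hm0 (by linarith)]
      simp
    rw [← h] at key
    exact (ENNReal.add_le_add_iff_right
      (ENNReal.mul_ne_top (ENNReal.natCast_ne_top _) ENNReal.ofReal_ne_top)).mp (by rwa [h] at key ⊢)
  · obtain ⟨hvT, hvu, hne, -⟩ := mem_children.mp hv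
    rw [volume_squareCorner hvu]
    have h := hf.packing_comparable hX (hT hu) (hT hvT) hne.symm hvu.1.1 hvu.2.1 hvu.1.2
    have h1 : v 0 - u 0 ∈ Icc (0 : ℝ) 1 := ⟨by linarith [hvu.1.1], by linarith [hvu.1.2]⟩
    have h2 := hm _ h1
    rw [stairArea] at h2
    apply ENNReal.ofReal_le_ofReal
    nlinarith [mul_nonneg (sub_nonneg.mpr h1.2) (sub_nonneg.mpr h)]

theorem upperDensityIn_le {X : Set Plane} (hX : IsPacking (translates (regionUnder f) X))
    {m : ℝ} (hm : ∀ y ∈ Icc (0 : ℝ) 1, m ≤ stairArea f y) (hm0 : 0 < m) (r : ℝ) :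
    upperDensityIn (translates (regionUnder f) X) (Metric.closedBall 0 r) ≤
      volume (regionUnder f) / ENNReal.ofReal m *
        (volume (Metric.closedBall (0 : Plane) (r + 4)) /
          volume (Metric.closedBall (0 : Plane) r)) := by
  classical
  rw [upperDensityIn, ← mul_div_assoc]
  gcongr
  -- Passing to finite subfamilies makes the cell count applicable and needs no countability of `X`.
  rw [ENNReal.tsum_eq_iSup_sum]
  refine iSup_le fun s => ?_
  simp only [volume_translates, Finset.sum_const, nsmul_eq_mul]
  have hcard := hf.card_mul_le_volume hX hm hm0.le (T := s.image fun i => (i.1 : Plane))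
    (B := Metric.closedBall 0 (r + 4)) ?_ ?_
  · rw [Finset.card_image_of_injective s (f := fun i => (i.1 : Plane))
        (Subtype.val_injective.comp Subtype.val_injective),
      ← ENNReal.le_div_iff_mul_le (Or.inl (by simpa using hm0))
      (Or.inl ENNReal.ofReal_ne_top)] at hcard
    calc (s.card : ℝ≥0∞) * volume (regionUnder f) ≤ _ := mul_le_mul_left hcard _
      _ = _ := by
        rw [div_eq_mul_inv, div_eq_mul_inv]
        ring
  · intro u hu
    obtain ⟨i, -, rfl⟩ := Finset.mem_image.mp hu
    exact i.1.2
  · intro u hu p hp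
    obtain ⟨i, -, rfl⟩ := Finset.mem_image.mp hu
    obtain ⟨q, hq, hqr⟩ := i.2
    rw [mem_translates] at hq
    rw [mem_closedBall_zero_iff] at hqr ⊢
    have h1 := hf.norm_le_two_of_mem_regionUnder hq
    have h2 : ‖p - (i.1 : Plane)‖ ≤ 2 := by
      apply norm_le_two <;> simp only [PiLp.sub_apply]
      · linarith [hp.1.1]
      · linarith [hp.1.2]
      · linarith [hp.2.1]
      · linarith [hp.2.2]
    -- The constant `4` is `2` for the unit square plus `2` for the copy that meets the disk.
    calc ‖p‖ = ‖(p - (i.1 : Plane)) - (q - (i.1 : Plane)) + q‖ := by congr 1; abel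
      _ ≤ ‖p - (i.1 : Plane)‖ + ‖q - (i.1 : Plane)‖ + ‖q‖ :=
        (norm_add_le _ _).trans (add_le_add_left (norm_sub_le _ _) _)
      _ ≤ r + 4 := by linarith

theorem upperDensity_le {X : Set Plane} (hX : IsPacking (translates (regionUnder f) X))
    {m : ℝ} (hm : ∀ y ∈ Icc (0 : ℝ) 1, m ≤ stairArea f y) (hm0 : 0 < m) :
    upperDensity (translates (regionUnder f) X) ≤
      volume (regionUnder f) / ENNReal.ofReal m := by
  rw [← (Plane.tendsto_mul_volume_closedBall_div (volume (regionUnder f) / ENNReal.ofReal m) 4).limsup_eq]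
  exact limsup_le_limsup (Eventually.of_forall fun r => hf.upperDensityIn_le hX hm hm0 r)

end IsQuarterProfile

/-! ### The tiling by stair polygons -/

section StairLattice

variable {x y : ℝ}

/-- Solving for `l` gives `l ≥ 0`. If `l ≥ 1`, then `k ≤ -1` forces `a ≥ 1`, `k ≥ 1` forces `b ≥ 1`,
and `k = 0` forces `a ≥ x` and `b ≥ y`. -/
theorem stairLattice_eq_zero_of_nonneg (hx : x ∈ Icc (0 : ℝ) 1) (hy : y ∈ Icc (0 : ℝ) 1)
    (hD : 0 < x + (1 - x) * y) {k l : ℤ} {a b : ℝ} (ha : a = k * (x - 1) + l * x)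
    (hb : b = k + l * y) (ha0 : 0 ≤ a) (hb0 : 0 ≤ b) (ha1 : a < 1) (hb1 : b < 1)
    (hab : a < x ∨ b < y) : k = 0 ∧ l = 0 := by
  have hl : (0 : ℝ) ≤ l := by
    have h : (l : ℝ) * (x + (1 - x) * y) = a + (1 - x) * b := by rw [ha, hb]; ring
    have h' : 0 ≤ (l : ℝ) * (x + (1 - x) * y) := by
      rw [h]
      exact add_nonneg ha0 (mul_nonneg (sub_nonneg.mpr hx.2) hb0)
    exact nonneg_of_mul_nonneg_left h' hD
  have hl' : 0 ≤ l := by exact_mod_cast hl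
  obtain rfl | hl1 := hl'.eq_or_lt
  · simp only [Int.cast_zero, zero_mul, add_zero] at hb
    rw [hb] at hb0 hb1
    norm_cast at hb0 hb1
    exact ⟨by omega, rfl⟩
  · have hl2 : (1 : ℝ) ≤ l := by exact_mod_cast hl1
    have hlx := mul_le_mul_of_nonneg_right hl2 hx.1
    have hly := mul_le_mul_of_nonneg_right hl2 hy.1
    exfalso
    rcases lt_trichotomy k 0 with hk | rfl | hk
    · have hk' : (k : ℝ) ≤ -1 := by exact_mod_cast (by omega : k ≤ -1)
      nlinarith [mul_nonneg (sub_nonneg.mpr hk') (sub_nonneg.mpr hx.2)]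
    · simp only [Int.cast_zero, zero_mul, zero_add] at ha hb
      rcases hab with h | h <;> linarith
    · have hk' : (1 : ℝ) ≤ k := by exact_mod_cast hk
      linarith [hy.1]

theorem stairLattice_not_incomparable (hx : x ∈ Icc (0 : ℝ) 1) (hy : y ∈ Icc (0 : ℝ) 1)
    (hD : 0 < x + (1 - x) * y) {k l : ℤ} {a b : ℝ} (ha : a = k * (x - 1) + l * x)
    (hb : b = k + l * y) (ha0 : 0 < a) (hb0 : b < 0) (ha1 : a < 1) (hb1 : -1 < b) : False := by
  have hk : (k : ℝ) ≤ 0 := by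
    have h : (k : ℝ) * (x + (1 - x) * y) = x * b - y * a := by rw [ha, hb]; ring
    by_contra! hk
    nlinarith [mul_pos hk hD, mul_nonneg hx.1 (neg_nonneg.mpr hb0.le), mul_nonneg hy.1 ha0.le]
  have hk' : k ≤ 0 := by exact_mod_cast hk
  obtain rfl | hk1 := hk'.eq_or_lt
  · simp only [Int.cast_zero, zero_mul, zero_add] at ha hb
    have h1 : 0 < (l : ℝ) := pos_of_mul_pos_left (ha ▸ ha0) hx.1
    linarith [mul_nonneg h1.le hy.1]
  · have hk2 : (k : ℝ) ≤ -1 := by exact_mod_cast (by omega : k ≤ -1)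
    have hl : 0 < (l : ℝ) := pos_of_mul_pos_left (by linarith : 0 < (l : ℝ) * y) hy.1
    have hl1 : (1 : ℝ) ≤ l := by exact_mod_cast (by exact_mod_cast hl : 0 < l)
    nlinarith [mul_nonneg (sub_nonneg.mpr hk2) (sub_nonneg.mpr hx.2),
      mul_le_mul_of_nonneg_right hl1 hx.1]

/-- Two points of the open stair polygon do not differ by a nonzero lattice vector. -/
theorem stairLattice_eq_zero (hx : x ∈ Icc (0 : ℝ) 1) (hy : y ∈ Icc (0 : ℝ) 1)
    (hD : 0 < x + (1 - x) * y) {k l : ℤ} {p₀ p₁ q₀ q₁ : ℝ}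
    (h0 : p₀ - q₀ = k * (x - 1) + l * x) (h1 : p₁ - q₁ = k + l * y)
    (hp₀ : p₀ ∈ Ioo (0 : ℝ) 1) (hp₁ : p₁ ∈ Ioo (0 : ℝ) 1) (hp : p₀ < x ∨ p₁ < y)
    (hq₀ : q₀ ∈ Ioo (0 : ℝ) 1) (hq₁ : q₁ ∈ Ioo (0 : ℝ) 1) (hq : q₀ < x ∨ q₁ < y) :
    k = 0 ∧ l = 0 := by
  obtain ⟨hp₀, hp₀'⟩ := hp₀
  obtain ⟨hp₁, hp₁'⟩ := hp₁
  obtain ⟨hq₀, hq₀'⟩ := hq₀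
  obtain ⟨hq₁, hq₁'⟩ := hq₁
  have h0' : q₀ - p₀ = (-k : ℤ) * (x - 1) + (-l : ℤ) * x := by push_cast; linarith
  have h1' : q₁ - p₁ = (-k : ℤ) + (-l : ℤ) * y := by push_cast; linarith
  rcases le_or_gt q₀ p₀ with ha | ha <;> rcases le_or_gt q₁ p₁ with hb | hb
  · exact stairLattice_eq_zero_of_nonneg hx hy hD h0 h1 (by linarith) (by linarith) (by linarith)
      (by linarith) (hp.imp (by intro; linarith) (by intro; linarith))
  · rcases ha.eq_or_lt with ha' | ha'
    · have := stairLattice_eq_zero_of_nonneg hx hy hD h0' h1' (by linarith) (by linarith)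
        (by linarith) (by linarith) (hq.imp (by intro; linarith) (by intro; linarith))
      omega
    · exact (stairLattice_not_incomparable hx hy hD h0 h1 (by linarith) (by linarith)
        (by linarith) (by linarith)).elim
  · rcases hb.eq_or_lt with hb' | hb'
    · have := stairLattice_eq_zero_of_nonneg hx hy hD h0' h1' (by linarith) (by linarith)
        (by linarith) (by linarith) (hq.imp (by intro; linarith) (by intro; linarith))
      omega
    · exact (stairLattice_not_incomparable hx hy hD h0' h1' (by linarith) (by linarith)
        (by linarith) (by linarith)).elim
  · have := stairLattice_eq_zero_of_nonneg hx hy hD h0' h1' (by linarith) (by linarith)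
      (by linarith) (by linarith) (hq.imp (by intro; linarith) (by intro; linarith))
    omega

/-- Only finitely many lattice points have bounded coordinates. -/
theorem stairLattice_finite (hx : x ∈ Icc (0 : ℝ) 1) (hy : y ∈ Icc (0 : ℝ) 1)
    (hD : 0 < x + (1 - x) * y) (a₀ a₁ b₀ b₁ : ℝ) :
    {n : ℤ × ℤ | n.1 * (x - 1) + n.2 * x ∈ Icc a₀ a₁ ∧ n.1 + n.2 * y ∈ Icc b₀ b₁}.Finite := by
  set D := x + (1 - x) * y
  refine ((finite_Icc ⌈(x * b₀ - y * a₁) / D⌉ ⌊(x * b₁ - y * a₀) / D⌋).prod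
    (finite_Icc ⌈(a₀ + (1 - x) * b₀) / D⌉ ⌊(a₁ + (1 - x) * b₁) / D⌋)).subset ?_
  rintro ⟨k, l⟩ ⟨⟨h1, h2⟩, h3, h4⟩
  have hx' := sub_nonneg.mpr hx.2
  -- Cramer's rule; the determinant of the two generators is `-D`.
  have hk : (k : ℝ) * D = x * (k + l * y) - y * (k * (x - 1) + l * x) := by ring
  have hl : (l : ℝ) * D = (k * (x - 1) + l * x) + (1 - x) * (k + l * y) := by ring
  have e1 := mul_le_mul_of_nonneg_left h1 hy.1
  have e2 := mul_le_mul_of_nonneg_left h2 hy.1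
  have e3 := mul_le_mul_of_nonneg_left h3 hx.1
  have e4 := mul_le_mul_of_nonneg_left h4 hx.1
  have e5 := mul_le_mul_of_nonneg_left h3 hx'
  have e6 := mul_le_mul_of_nonneg_left h4 hx'
  refine ⟨⟨Int.ceil_le.mpr ?_, Int.le_floor.mpr ?_⟩, Int.ceil_le.mpr ?_, Int.le_floor.mpr ?_⟩
  · rw [div_le_iff₀ hD, hk]
    linarith
  · rw [le_div_iff₀ hD, hk]
    linarith
  · rw [div_le_iff₀ hD, hl]
    linarith
  · rw [le_div_iff₀ hD, hl]
    linarith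

theorem stairLattice_exists_le (hx : x ∈ Icc (0 : ℝ) 1) (hy : y ∈ Icc (0 : ℝ) 1)
    (hD : 0 < x + (1 - x) * y) (z₀ z₁ : ℝ) :
    ∃ k l : ℤ, k * (x - 1) + l * x ≤ z₀ ∧ k + l * y ≤ z₁ := by
  set D := x + (1 - x) * y with hDdef
  -- These are the real lattice coordinates of `(z₀ - 1, z₁)`. Rounding `κ` down raises the first
  -- coordinate by at most `1 - x`, which the shift by `1` absorbs; all other rounding only lowers
  -- coordinates.
  set κ := (x * z₁ - y * (z₀ - 1)) / D with hκ
  set μ := ((z₀ - 1) + (1 - x) * z₁) / D with hμ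
  have h0 : κ * (x - 1) + μ * x = z₀ - 1 := by
    rw [hκ, hμ]
    field_simp
    rw [hDdef]
    ring
  have h1 : κ + μ * y = z₁ := by
    rw [hκ, hμ]
    field_simp
    rw [hDdef]
    ring
  have hk := Int.floor_le κ
  have hk' := Int.lt_floor_add_one κ
  have hl := mul_nonneg (sub_nonneg.mpr (Int.floor_le μ)) hx.1
  have hl' := mul_nonneg (sub_nonneg.mpr (Int.floor_le μ)) hy.1
  have e := mul_le_mul_of_nonneg_right (by linarith : κ - ⌊κ⌋ ≤ 1) (sub_nonneg.mpr hx.2)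
  refine ⟨⌊κ⌋, ⌊μ⌋, ?_, ?_⟩
  · linarith [hx.1]
  · linarith

/-- Take a lattice point below `z` that maximizes a positive linear functional. The weights `1 + x`
and `1 + y` make it increase along `(1, y - 1)`, `(x - 1, 1)` and `(x, y)`, by `x + y ^ 2`, `x ^ 2 +
y` and `x + x ^ 2 + y + y ^ 2`. None of these steps can stay below `z`, which gives the three upper
bounds. -/
theorem stairLattice_cover (hx : x ∈ Icc (0 : ℝ) 1) (hy : y ∈ Icc (0 : ℝ) 1)
    (hxy : 1 - x ≤ y) (z₀ z₁ : ℝ) :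
    ∃ k l : ℤ, k * (x - 1) + l * x ≤ z₀ ∧ k + l * y ≤ z₁ ∧ z₀ < k * (x - 1) + l * x + 1 ∧
      z₁ < k + l * y + 1 ∧ (z₀ < k * (x - 1) + l * x + x ∨ z₁ < k + l * y + y) := by
  have hx0 := hx.1
  have hx1 := hx.2
  have hD : 0 < x + (1 - x) * y := by nlinarith
  let A : ℤ × ℤ → ℝ := fun n => n.1 * (x - 1) + n.2 * x
  let B : ℤ × ℤ → ℝ := fun n => n.1 + n.2 * y
  let φ : ℤ × ℤ → ℝ := fun n => (1 + x) * A n + (1 + y) * B n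
  obtain ⟨k₀, l₀, hk₀, hl₀⟩ := stairLattice_exists_le hx hy hD z₀ z₁
  let s : Set (ℤ × ℤ) := {n | A n ≤ z₀ ∧ B n ≤ z₁ ∧ φ (k₀, l₀) ≤ φ n}
  have hs : s.Finite := by
    refine (stairLattice_finite hx hy hD ((φ (k₀, l₀) - (1 + y) * z₁) / (1 + x)) z₀
      ((φ (k₀, l₀) - (1 + x) * z₀) / (1 + y)) z₁).subset ?_
    rintro n ⟨h1, h2, h3⟩
    have hx' : 0 < 1 + x := by linarith
    have hy' : 0 < 1 + y := by linarith [hy.1]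
    have e1 := mul_le_mul_of_nonneg_left h1 hx'.le
    have e2 := mul_le_mul_of_nonneg_left h2 hy'.le
    have h3' : φ (k₀, l₀) ≤ (1 + x) * A n + (1 + y) * B n := h3
    refine ⟨⟨?_, h1⟩, ?_, h2⟩
    · rw [div_le_iff₀ hx']
      change _ ≤ A n * (1 + x)
      linarith
    · rw [div_le_iff₀ hy']
      change _ ≤ B n * (1 + y)
      linarith
  obtain ⟨⟨k, l⟩, ⟨h1, h2, h3⟩, hmax⟩ := hs.exists_maximalFor φ s ⟨(k₀, l₀), hk₀, hl₀, le_rfl⟩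
  have step : ∀ i j : ℤ, 0 < (1 + x) * (i * (x - 1) + j * x) + (1 + y) * (i + j * y) →
      z₀ < A (k, l) + (i * (x - 1) + j * x) ∨ z₁ < B (k, l) + (i + j * y) := by
    intro i j hpos
    have hA : A (k + i, l + j) = A (k, l) + (i * (x - 1) + j * x) := by simp [A]; ring
    have hB : B (k + i, l + j) = B (k, l) + (i + j * y) := by simp [B]; ring
    have hφ : φ (k, l) < φ (k + i, l + j) := by
      change (1 + x) * A (k, l) + (1 + y) * B (k, l) <
        (1 + x) * A (k + i, l + j) + (1 + y) * B (k + i, l + j)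
      rw [hA, hB]
      linarith
    by_contra! hle
    exact (hmax ⟨hA ▸ hle.1, hB ▸ hle.2, h3.trans hφ.le⟩ hφ.le).not_gt hφ
  refine ⟨k, l, h1, h2, ?_, ?_, ?_⟩
  · rcases step (-1) 1 (by push_cast; nlinarith [hy.1, hy.2]) with h | h
    · push_cast at h
      change _ < A (k, l) + 1
      linarith
    · push_cast at h
      linarith [hy.2]
  · rcases step 1 0 (by push_cast; nlinarith [hy.1, hy.2]) with h | h
    · push_cast at h
      linarith
    · push_cast at h
      change _ < B (k, l) + 1
      linarith
  · simpa [A, B] using step 0 1 (by push_cast; nlinarith [hy.1, hy.2])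

end StairLattice

/-- Moving both ways along the diagonal turns the weak inequalities of the stair polygon into strict
ones, without computing its interior. -/
theorem Plane.exists_diagonal_mem_of_mem_interior {K : Set Plane} {p : Plane}
    (hp : p ∈ interior K) :
    ∃ ε : ℝ, 0 < ε ∧ p + ε • !₂[1, 1] ∈ K ∧ p - ε • !₂[1, 1] ∈ K := by
  have hc : Continuous fun t : ℝ => p + t • (!₂[1, 1] : Plane) := by fun_prop
  have hn : ∀ᶠ t : ℝ in nhds 0, p + t • (!₂[1, 1] : Plane) ∈ K :=
    hc.continuousAt.eventually_mem (by simpa using mem_interior_iff_mem_nhds.mp hp)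
  obtain ⟨δ, hδ, h⟩ := Metric.eventually_nhds_iff.mp hn
  refine ⟨δ / 2, by positivity, h ?_, ?_⟩
  · rw [Real.dist_0_eq_abs, abs_of_pos (by positivity)]
    linarith
  · rw [sub_eq_add_neg, ← neg_smul]
    apply h
    rw [Real.dist_0_eq_abs, abs_neg, abs_of_pos (by positivity)]
    linarith

/-! ### From lattice arithmetic to the tiling -/

namespace IsQuarterProfile

variable {f : ℝ → ℝ} (hf : IsQuarterProfile f)
include hf

theorem of_mem_interior_translates_stairPolygon {x : ℝ} (hx : x ∈ Icc (0 : ℝ) 1) {X : Set Plane}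
    {u : X} {p : Plane} (hp : p ∈ interior (translates (stairPolygon f x) X u)) :
    p 0 - (u : Plane) 0 ∈ Ioo (0 : ℝ) 1 ∧ p 1 - (u : Plane) 1 ∈ Ioo (0 : ℝ) 1 ∧
      (p 0 - (u : Plane) 0 < x ∨ p 1 - (u : Plane) 1 < f x) := by
  obtain ⟨ε, hε, h1, h2⟩ := Plane.exists_diagonal_mem_of_mem_interior hp
  rw [mem_translates] at h1 h2
  have h3 := hf.stairPolygon_subset_unitSquare hx h1
  have h4 := hf.stairPolygon_subset_unitSquare hx h2
  simp at h3 h4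
  refine ⟨⟨by linarith, by linarith⟩, ⟨by linarith, by linarith⟩, ?_⟩
  rcases h1 with ⟨-, h, -, -⟩ | ⟨-, -, -, h⟩ <;> simp at h
  · exact Or.inl (by linarith)
  · exact Or.inr (by linarith)

theorem isPacking_stairPolygon {x : ℝ} (hx : x ∈ Icc (0 : ℝ) 1) :
    IsPacking (translates (stairPolygon f x) (planeLattice !₂[x - 1, 1] !₂[x, f x])) := by
  intro i j hij
  obtain ⟨k, l, hi⟩ := i.2
  obtain ⟨k', l', hj⟩ := j.2
  refine Set.disjoint_left.mpr fun p hp hq => ?_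
  obtain ⟨h1, h2, h3⟩ := hf.of_mem_interior_translates_stairPolygon hx hp
  obtain ⟨h4, h5, h6⟩ := hf.of_mem_interior_translates_stairPolygon hx hq
  have := stairLattice_eq_zero (k := k' - k) (l := l' - l) hx ⟨hf.nonneg hx, hf.le_one hx⟩
    (hf.stairArea_pos hx) ?_ ?_ h1 h2 h3 h4 h5 h6
  · apply hij
    rw [Subtype.ext_iff, hi, hj, show k = k' by omega, show l = l' by omega]
  · simp [hi, hj]
    ring
  · simp [hi, hj]
    ring

theorem isCovering_stairPolygon {x : ℝ} (hx : x ∈ Icc (0 : ℝ) 1) :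
    IsCovering (translates (stairPolygon f x) (planeLattice !₂[x - 1, 1] !₂[x, f x])) := by
  intro z
  obtain ⟨k, l, h1, h2, h3, h4, h5⟩ :=
    stairLattice_cover hx ⟨hf.nonneg hx, hf.le_one hx⟩ (hf.one_sub_le hx) (z 0) (z 1)
  refine ⟨⟨(k : ℝ) • !₂[x - 1, 1] + (l : ℝ) • !₂[x, f x], k, l, rfl⟩, ?_⟩
  rw [mem_translates]
  by_cases h : z 0 < k * (x - 1) + l * x + x
  · left
    refine ⟨?_, ?_, ?_, ?_⟩ <;> simp <;> linarith
  · right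
    have h6 := h5.resolve_left h
    refine ⟨?_, ?_, ?_, ?_⟩ <;> simp <;> linarith

theorem linearIndependent_stairLattice {x : ℝ} (hx : x ∈ Icc (0 : ℝ) 1) :
    LinearIndependent ℝ ![(!₂[x - 1, 1] : Plane), !₂[x, f x]] := by
  rw [LinearIndependent.pair_iff]
  intro s t h
  have h0 := congrArg (fun p : Plane => p 0) h
  have h1 := congrArg (fun p : Plane => p 1) h
  simp at h0 h1
  have ht : t * stairArea f x = 0 := by
    rw [stairArea]
    linear_combination h0 + (1 - x) * h1
  have ht' : t = 0 := (mul_eq_zero.mp ht).resolve_right (hf.stairArea_pos hx).ne'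
  subst ht'
  exact ⟨by simpa using h1, rfl⟩

/-! ### The densities -/

theorem isPacking_regionUnder {x : ℝ} (hx : x ∈ Icc (0 : ℝ) 1) :
    IsPacking (translates (regionUnder f) (planeLattice !₂[x - 1, 1] !₂[x, f x])) :=
  fun _ _ hij => (hf.isPacking_stairPolygon hx hij).mono
    (interior_mono (image_mono (hf.regionUnder_subset_stairPolygon hx)))
    (interior_mono (image_mono (hf.regionUnder_subset_stairPolygon hx)))

theorem le_upperDensityIn {x : ℝ} (hx : x ∈ Icc (0 : ℝ) 1) (r : ℝ) :
    volume (regionUnder f) / ENNReal.ofReal (stairArea f x) *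
        (volume (Metric.closedBall (0 : Plane) (r + -2)) /
          volume (Metric.closedBall (0 : Plane) r)) ≤
      upperDensityIn (translates (regionUnder f) (planeLattice !₂[x - 1, 1] !₂[x, f x]))
        (Metric.closedBall 0 r) := by
  set Λ := planeLattice !₂[x - 1, 1] !₂[x, f x] with hΛ
  have hcount : Countable Λ := by
    have : Λ = range fun n : ℤ × ℤ =>
        (n.1 : ℝ) • (!₂[x - 1, 1] : Plane) + (n.2 : ℝ) • !₂[x, f x] := by
      ext z
      simp [hΛ, planeLattice, eq_comm]
    rw [this]
    exact (countable_range _).to_subtype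
  rw [upperDensityIn, ← mul_div_assoc]
  gcongr
  -- A tile that meets the smaller disk has its vertex `i` in the larger one, and `i` belongs to its
  -- own copy of the region, so that copy is counted.
  have hcov : Metric.closedBall (0 : Plane) (r + -2) ⊆
      ⋃ i : {i : Λ // (translates (regionUnder f) Λ i ∩ Metric.closedBall 0 r).Nonempty},
        translates (stairPolygon f x) Λ i := by
    intro z hz
    obtain ⟨i, hi⟩ := hf.isCovering_stairPolygon hx z
    refine mem_iUnion.mpr ⟨⟨i, i, ?_, ?_⟩, hi⟩
    · rw [mem_translates, sub_self]
      simp [regionUnder, hf.map_zero]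
    · rw [mem_translates] at hi
      rw [mem_closedBall_zero_iff] at hz ⊢
      have h1 := hf.norm_le_two_of_mem_stairPolygon hx hi
      have h2 : ‖(i : Plane)‖ ≤ ‖z‖ + ‖z - i‖ := by simpa using norm_sub_le z (z - i)
      linarith
  have hA : ENNReal.ofReal (stairArea f x) ≠ 0 := by simpa using hf.stairArea_pos hx
  have hvol := (measure_mono (μ := volume) hcov).trans (measure_iUnion_le _)
  simp only [volume_translates, volume_stairPolygon hx (hf.nonneg hx)] at hvol ⊢
  calc _ ≤ volume (regionUnder f) / ENNReal.ofReal (stairArea f x) * _ := mul_le_mul_right hvol _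
    _ = _ := by
      rw [← ENNReal.tsum_mul_left, ENNReal.div_mul_cancel hA ENNReal.ofReal_ne_top]

theorem le_upperDensity {x : ℝ} (hx : x ∈ Icc (0 : ℝ) 1) :
    volume (regionUnder f) / ENNReal.ofReal (stairArea f x) ≤
      upperDensity (translates (regionUnder f) (planeLattice !₂[x - 1, 1] !₂[x, f x])) := by
  rw [← (Plane.tendsto_mul_volume_closedBall_div 
    (volume (regionUnder f) / ENNReal.ofReal (stairArea f x)) (-2)).limsup_eq]
  exact limsup_le_limsup (Eventually.of_forall fun r => hf.le_upperDensityIn hx r)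

end IsQuarterProfile

theorem latticePackingDensity_le_translativePackingDensity (K : Set Plane) :
    latticePackingDensity K ≤ translativePackingDensity K :=
  iSup_le fun v => iSup_le fun w => iSup_le fun _ => iSup_le fun h =>
    le_iSup₂ (f := fun (X : Set Plane) (_ : IsPacking (translates K X)) =>
      upperDensity (translates K X)) (planeLattice v w) h

theorem mainTheorem6 (f : ℝ → ℝ)
    (hconc : ConcaveOn ℝ (Set.Icc 0 1) f) (hanti : AntitoneOn f (Set.Icc 0 1))
    (hcont : ContinuousOn f (Set.Icc 0 1)) (hf0 : f 0 = 1) (hf1 : 0 ≤ f 1) :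
    (∀ x ∈ Set.Icc (0 : ℝ) 1,
      regionUnder f ⊆ stairPolygon f x ∧
      LinearIndependent ℝ ![(!₂[x - 1, 1] : Plane), !₂[x, f x]] ∧
      IsTiling (translates (stairPolygon f x) (planeLattice !₂[x - 1, 1] !₂[x, f x]))) ∧
    (∃ x ∈ Set.Icc (0 : ℝ) 1, volume (stairPolygon f x) = minStairArea f) ∧
    latticePackingDensity (regionUnder f) = volume (regionUnder f) / minStairArea f ∧
    translativePackingDensity (regionUnder f) = volume (regionUnder f) / minStairArea f := by
  have hf : IsQuarterProfile f := ⟨hconc, hanti, hcont, hf0, hf1⟩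
  obtain ⟨x, hx, hmin⟩ := hf.exists_stairArea_min
  have hA := hf.minStairArea_eq hx hmin
  have hlower : volume (regionUnder f) / minStairArea f ≤ latticePackingDensity (regionUnder f) := by
    rw [hA]
    refine (hf.le_upperDensity hx).trans ?_
    exact le_iSup₂_of_le _ _ (le_iSup₂_of_le (hf.linearIndependent_stairLattice hx)
      (hf.isPacking_regionUnder hx) le_rfl)
  have hupper : translativePackingDensity (regionUnder f) ≤
      volume (regionUnder f) / minStairArea f := by
    rw [hA]
    exact iSup₂_le fun X hX => hf.upperDensity_le hX hmin (hf.stairArea_pos hx)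
  have hle := latticePackingDensity_le_translativePackingDensity (regionUnder f)
  refine ⟨fun y hy => ⟨hf.regionUnder_subset_stairPolygon hy,
    hf.linearIndependent_stairLattice hy, hf.isPacking_stairPolygon hy,
    hf.isCovering_stairPolygon hy⟩, ⟨x, hx, ?_⟩, ?_, ?_⟩
  · rw [volume_stairPolygon hx (hf.nonneg hx), hA]
  · exact le_antisymm (hle.trans hupper) hlower
  · exact le_antisymm hupper (hlower.trans hle)
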